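/- Let $\gamma:[0,T]\to\mathbb{R}^d$ be a non-degenerate piecewise linear path: $\gamma$ is continuous and there is a partition $0=t_0<t_1<\dots<t_r=T$ such that $\gamma$ is linear (affine) on each $[t_{i-1},t_i]$, every edge $[\gamma_{t_{i-1}},\gamma_{t_i}]$ ($0<i\le r$) is non-zero, and no two adjacent edges $[\gamma_{t_{i-1}},\gamma_{t_i}]$, $[\gamma_{t_i},\gamma_{t_{i+1}}]$ ($0<i<r$) are collinear. Suppose $r\ge 1$, let $D>0$ be the (Euclidean) length of the shortest edge, and let $2\theta$ be the smallest of the angles $\angle\gamma_{t_{i-1}}\gamma_{t_i}\gamma_{t_{i+1}}\in(0,\pi)$, $0<i<r$, between adjacent edges (if $r=1$ there are no such angles, and $\theta$ may be any number in $(0,\pi/2]$). Equip $(\mathbb{R}^d)^{\otimes n}$ with the projective tensor norm built from the Euclidean norm of $\mathbb{R}^d$. Then there is at least one integer $n\ge 0$ for which $$\left(\frac{2}{1-\cos\theta}\right)^{1-\frac1D}\;\le\; n!\,\Bigl\|\int_{0<u_1<\dots<u_n<T} d\gamma_{u_1}\otimes\cdots\otimes d\gamma_{u_n}\Bigr\|$$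 (the term for $n=0$ being $1$). Moreover, $\gamma$ has non-trivial signature: for some $n\ge 1$ the iterated integral $\int_{0<u_1<\dots<u_n<T} d\gamma_{u_1}\otimes\cdots\otimes d\gamma_{u_n}$ is non-zero. -/

import Mathlib

open MeasureTheory Set
open scoped TensorProduct

noncomputable section

namespace PathSignature

variable {d : ℕ}

/-- The open simplex `{0 < u₁ < ... < uₙ < T}`. -/
def simplex (T : ℝ) (n : ℕ) : Set (Fin n → ℝ) :=
  {u | StrictMono u ∧ ∀ k, u k ∈ Ioo 0 T}

/-- The coordinate iterated integral `∫_{0<u₁<...<uₙ<T} dγ^{I 1}_{u₁} ... dγ^{I n}_{uₙ}` of a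
Lipschitz (in particular, of a piecewise linear) path `γ : [0,T] → ℝᵈ`; for such paths
`dγ_u = γ'(u) du`, where `γ'` exists almost everywhere (everywhere except at the
finitely many breakpoints if `γ` is piecewise linear).
Only the values of `γ` on `(0,T)` enter. -/
def coordIteratedIntegral (γ : ℝ → EuclideanSpace ℝ (Fin d)) (T : ℝ) {n : ℕ}
    (I : Fin n → Fin d) : ℝ :=
  ∫ u in simplex T n, ∏ k, deriv (fun s => γ s (I k)) (u k)

/-- The `n`-th term `∫_{0<u₁<...<uₙ<T} dγ_{u₁} ⊗ ... ⊗ dγ_{uₙ}` of the signature of `γ`,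
an element of the `n`-th tensor power of `ℝᵈ`, given by its coordinates in the basis
`e_{I 1} ⊗ ... ⊗ e_{I n}`. For `n = 0` it is the unit scalar (the empty tensor product).

The norm that Mathlib puts on `⨂[ℝ]^n E` is the projective tensor norm
`‖x‖ = inf {∑ⱼ ∏ₖ ‖v_{j,k}‖ : x = ∑ⱼ v_{j,1} ⊗ ... ⊗ v_{j,n}}`. -/
def iteratedIntegral (γ : ℝ → EuclideanSpace ℝ (Fin d)) (T : ℝ) (n : ℕ) :
    ⨂[ℝ]^n (EuclideanSpace ℝ (Fin d)) :=
  ∑ I : Fin n → Fin d, coordIteratedIntegral γ T I •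
    PiTensorProduct.tprod ℝ (fun k => EuclideanSpace.single (I k) (1 : ℝ))

/-- The signature `(1, X¹, X², ...)` of `γ` on `[0,T]` is trivial if it is `(1, 0, 0, ...)`. -/
def HasTrivialSignature (γ : ℝ → EuclideanSpace ℝ (Fin d)) (T : ℝ) : Prop :=
  ∀ n : ℕ, 1 ≤ n → iteratedIntegral γ T n = 0

/-- `γ` is a piecewise linear path on `[0,T]`, linear on each of the `r` segments of the
partition `0 = t 0 < t 1 < ... < t r = T`. -/
structure IsPiecewiseLinear (γ : ℝ → EuclideanSpace ℝ (Fin d)) (T : ℝ) (r : ℕ) (t : ℕ → ℝ) :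
    Prop where
  zero : t 0 = 0
  last : t r = T
  lt_succ : ∀ i < r, t i < t (i + 1)
  continuousOn : ContinuousOn γ (Icc 0 T)
  linear : ∀ i < r, ∀ u ∈ Icc (t i) (t (i + 1)),
    γ u = AffineMap.lineMap (γ (t i)) (γ (t (i + 1))) ((u - t i) / (t (i + 1) - t i))

/-- The partition exhibits `γ` as a non-degenerate piecewise linear path: no edge is zero and
no two adjacent edges are collinear. -/
structure IsNondegenerate (γ : ℝ → EuclideanSpace ℝ (Fin d)) (T : ℝ) (r : ℕ) (t : ℕ → ℝ) : Prop
    extends IsPiecewiseLinear γ T r t where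
  edge_ne : ∀ i < r, γ (t i) ≠ γ (t (i + 1))
  not_collinear : ∀ i, i + 1 < r →
    ¬ Collinear ℝ {γ (t i), γ (t (i + 1)), γ (t (i + 2))}

/-- The lengths of the edges of the path. -/
def edgeLengths (γ : ℝ → EuclideanSpace ℝ (Fin d)) (r : ℕ) (t : ℕ → ℝ) : Set ℝ :=
  {l | ∃ i < r, l = dist (γ (t i)) (γ (t (i + 1)))}

/-- The (interior) angles at the vertices between adjacent edges of the path: `0` means that
the path turns back on itself, `π` that it goes straight on. -/
def adjacentAngles (γ : ℝ → EuclideanSpace ℝ (Fin d)) (r : ℕ) (t : ℕ → ℝ) : Set ℝ :=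
  {φ | ∃ i, i + 1 < r ∧
    φ = EuclideanGeometry.angle (γ (t i)) (γ (t (i + 1))) (γ (t (i + 2)))}

end PathSignature

end

/-! ### The ordered simplex -/

namespace PathSignature

/-! The path is developed into the Lorentz group acting on `ℝ × E`, with `E = ℝᵈ`. A linear map `F`
from `E` to a Banach algebra turns the signature into the series of terms `tensorDevelopment F n` of
`Xⁿ`. Its sum is the ordered product of the exponentials of `F` on the edges
(`hasSum_algIteratedIntegral`, Chen's identity), and its `n`-th term has norm at most `‖F‖ ^ n *
‖Xⁿ‖` because the tensor norm is projective.

Put `Q = 2 / (1 - cos θ)`, `K = log Q`, and let `F` be `K / D` times the generator of boosts, so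
that `‖F‖ ≤ K / D` while every edge becomes a boost of rapidity at least `K`. Such a boost throws
every light vector outside the cone of half-angle `θ` about its backward direction into the cone of
half-angle `θ` about its forward direction, without shortening it (`exp_boostGenerator_light`).
Adjacent edges make an angle at least `2 * θ`, so the forward cone of one edge avoids the backward
cone of the next one to act. Hence the product has norm at least `Q`
(`le_norm_prod_exp_boostGenerator`).

If every `n! ‖Xⁿ‖` were below `Q ^ (1 - 1 / D)`, the series would sum to less than `Q ^ (1 - 1 / D)
* exp (K / D) = Q`. If the signature were trivial, it would sum to at most `1 < Q`. -/

theorem measurableSet_simplex (T : ℝ) (n : ℕ) : MeasurableSet (simplex T n) := by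
  have h : simplex T n = (⋂ i, ⋂ j, ⋂ _ : i < j, {u : Fin n → ℝ | u i < u j}) ∩
      ⋂ k, (fun u : Fin n → ℝ => u k) ⁻¹' Ioo 0 T := by
    ext u
    simp [simplex, StrictMono]
  rw [h]
  refine MeasurableSet.inter ?_ ?_
  · exact .iInter fun i => .iInter fun j => .iInter fun _ =>
      measurableSet_lt (measurable_pi_apply i) (measurable_pi_apply j)
  · exact .iInter fun k => measurable_pi_apply k measurableSet_Ioo

theorem volume_simplex_lt_top (T : ℝ) (n : ℕ) : volume (simplex T n) < ⊤ := by
  have h : simplex T n ⊆ Icc (fun _ => 0) (fun _ => T) := fun u hu =>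
    ⟨fun k => (hu.2 k).1.le, fun k => (hu.2 k).2.le⟩
  exact (measure_mono h).trans_lt isCompact_Icc.measure_lt_top

theorem volume_real_simplex_zero (T : ℝ) : volume.real (simplex T 0) = 1 := by
  have h : simplex T 0 = univ := by
    ext u
    simp [simplex, Subsingleton.strictMono]
  have hv : (volume : Measure (Fin 0 → ℝ)) = Measure.dirac isEmptyElim :=
    volume_pi.trans (Measure.pi_of_empty _)
  simp [h, hv]

theorem insertNth_last_mem_simplex {t s : ℝ} {n : ℕ} {v : Fin n → ℝ} :
    ((Fin.last n).insertNth s v : Fin (n + 1) → ℝ) ∈ simplex t (n + 1) ↔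
      s ∈ Ioo 0 t ∧ v ∈ simplex s n := by
  have hc : ∀ i : Fin n, ((Fin.last n).insertNth s v : Fin (n + 1) → ℝ) i.castSucc = v i := by
    intro i
    simp
  have hl : ((Fin.last n).insertNth s v : Fin (n + 1) → ℝ) (Fin.last n) = s := by simp
  constructor
  · rintro ⟨hm, hI⟩
    have hs := hI (Fin.last n)
    rw [hl] at hs
    refine ⟨hs, fun i j hij => ?_, fun k => ⟨?_, ?_⟩⟩
    · rw [← hc i, ← hc j]
      exact hm (Fin.castSucc_lt_castSucc_iff.2 hij)
    · rw [← hc k]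
      exact (hI _).1
    · have := hm (Fin.castSucc_lt_last k)
      rwa [hc, hl] at this
  · rintro ⟨hs, hm, hI⟩
    refine ⟨fun i j hij => ?_, fun k => ?_⟩
    · induction j using Fin.lastCases with
      | last =>
        induction i using Fin.lastCases with
        | last => exact absurd hij (lt_irrefl _)
        | cast i => rw [hc, hl]; exact (hI i).2
      | cast j =>
        induction i using Fin.lastCases with
        | last => exact absurd (hij.trans (Fin.castSucc_lt_last j)) (lt_irrefl _)
        | cast i => rw [hc, hc]; exact hm (Fin.castSucc_lt_castSucc_iff.1 hij)
    · induction k using Fin.lastCases with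
      | last => rwa [hl]
      | cast k => rw [hc]; exact ⟨(hI k).1, (hI k).2.trans hs.2⟩

/-! ### Iterated integrals in a Banach algebra and Chen's identity -/

section Algebra

variable {A : Type*} [NormedRing A]

theorem stronglyMeasurable_ofFn_prod {f : ℝ → A} (hf : StronglyMeasurable f) (n : ℕ) :
    StronglyMeasurable fun u : Fin n → ℝ => (List.ofFn fun k => f (u k)).prod := by
  have : (fun u : Fin n → ℝ => (List.ofFn fun k => f (u k)).prod) =
      fun u => ((List.ofFn fun (k : Fin n) (u : Fin n → ℝ) => f (u k)).map fun g => g u).prod := by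
    ext u
    rw [List.map_ofFn]
    rfl
  rw [this]
  refine List.stronglyMeasurable_fun_prod _ fun g hg => ?_
  obtain ⟨k, rfl⟩ := (List.mem_ofFn' _ _).1 hg
  exact hf.comp_measurable (measurable_pi_apply k)

theorem norm_ofFn_prod_le [NormOneClass A] {f : ℝ → A} {C : ℝ} (hC : ∀ s, ‖f s‖ ≤ C) {n : ℕ} (u : Fin n → ℝ) :
    ‖(List.ofFn fun k => f (u k)).prod‖ ≤ C ^ n := by
  refine (List.norm_prod_le _).trans ?_
  rw [List.map_ofFn, List.prod_ofFn]
  refine (Finset.prod_le_prod (fun _ _ => norm_nonneg _) fun k _ => hC (u k)).trans ?_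
  simp

theorem integrableOn_ofFn_prod [NormOneClass A] {f : ℝ → A} (hf : StronglyMeasurable f) {C : ℝ}
    (hC : ∀ s, ‖f s‖ ≤ C) (n : ℕ) (t : ℝ) :
    IntegrableOn (fun u : Fin n → ℝ => (List.ofFn fun k => f (u k)).prod) (simplex t n) :=
  IntegrableOn.of_bound (volume_simplex_lt_top t n)
    (stronglyMeasurable_ofFn_prod hf n).aestronglyMeasurable (C ^ n)
    (Filter.Eventually.of_forall fun u => norm_ofFn_prod_le hC u)

variable [NormedAlgebra ℝ A]

/-- The iterated integral `∫_{0<u₁<...<uₙ<t} f(u₁) ⋯ f(uₙ) du` of a function with values in a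
Banach algebra. -/
noncomputable def algIteratedIntegral (f : ℝ → A) (n : ℕ) (t : ℝ) : A :=
  ∫ u in simplex t n, (List.ofFn fun k => f (u k)).prod

theorem algIteratedIntegral_zero [CompleteSpace A] (f : ℝ → A) (t : ℝ) :
    algIteratedIntegral f 0 t = 1 := by
  simp [algIteratedIntegral, volume_real_simplex_zero]

theorem algIteratedIntegral_succ_zero (f : ℝ → A) (n : ℕ) :
    algIteratedIntegral f (n + 1) 0 = 0 := by
  have h : simplex 0 (n + 1) = ∅ := by
    ext u
    simp only [simplex, mem_ofPred_eq, Ioo_self, mem_empty_iff_false, iff_false, not_and]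
    exact fun _ h => h 0
  simp [algIteratedIntegral, h]

variable [NormOneClass A] [CompleteSpace A]

/-- Fubini, with the simplex fibred over its largest coordinate by `insertNth_last_mem_simplex`. As
`A` need not be commutative, the last factor stays on the right. Integrability is recorded so that
the interval can later be split. -/
theorem algIteratedIntegral_succ {f : ℝ → A} (hf : StronglyMeasurable f) {C : ℝ}
    (hC : ∀ s, ‖f s‖ ≤ C) (n : ℕ) (t : ℝ) :
    IntegrableOn (fun s => algIteratedIntegral f n s * f s) (Ioo 0 t) ∧
    algIteratedIntegral f (n + 1) t = ∫ s in Ioo 0 t, algIteratedIntegral f n s * f s := by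
  set G : ∀ m, (Fin m → ℝ) → A := fun m u => (List.ofFn fun k => f (u k)).prod with hG
  set e := MeasurableEquiv.piFinSuccAbove (fun _ : Fin (n + 1) => ℝ) (Fin.last n) with he
  have hmp : MeasurePreserving e.symm :=
    (volume_preserving_piFinSuccAbove (fun _ : Fin (n + 1) => ℝ) (Fin.last n)).symm
  have hes : ∀ z : ℝ × (Fin n → ℝ), e.symm z = (Fin.last n).insertNth z.1 z.2 := fun _ => rfl
  have hval : ∀ z : ℝ × (Fin n → ℝ), (simplex t (n + 1)).indicator (G (n + 1)) (e.symm z) =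
      (Ioo 0 t).indicator (fun s => (simplex s n).indicator (G n) z.2 * f s) z.1 := by
    rintro ⟨s, v⟩
    rw [hes]
    have hGs : G (n + 1) ((Fin.last n).insertNth s v) = G n v * f s := by
      simp only [hG]
      rw [List.ofFn_succ', List.concat_eq_append, List.prod_append]
      simp
    by_cases hs : s ∈ Ioo 0 t
    · by_cases hv : v ∈ simplex s n
      · rw [indicator_of_mem (insertNth_last_mem_simplex.2 ⟨hs, hv⟩), hGs]
        simp only [indicator_of_mem hs, indicator_of_mem hv]
      · rw [indicator_of_notMem fun h => hv (insertNth_last_mem_simplex.1 h).2]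
        simp only [indicator_of_mem hs, indicator_of_notMem hv, zero_mul]
    · rw [indicator_of_notMem fun h => hs (insertNth_last_mem_simplex.1 h).1]
      simp only [indicator_of_notMem hs]
  have hint : Integrable ((simplex t (n + 1)).indicator (G (n + 1))) :=
    (integrableOn_ofFn_prod hf hC (n + 1) t).integrable_indicator (measurableSet_simplex _ _)
  have hint' : Integrable (fun z : ℝ × (Fin n → ℝ) =>
      (simplex t (n + 1)).indicator (G (n + 1)) (e.symm z)) (volume.prod volume) :=
    hmp.integrable_comp_of_integrable hint
  have hinner : ∀ s, ∫ v, (simplex t (n + 1)).indicator (G (n + 1)) (e.symm (s, v)) =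
      (Ioo 0 t).indicator (fun s => algIteratedIntegral f n s * f s) s := by
    intro s
    simp only [hval]
    by_cases hs : s ∈ Ioo 0 t
    · simp only [indicator_of_mem hs]
      have hi := (integrableOn_ofFn_prod hf hC n s).integrable_indicator
        (measurableSet_simplex s n)
      have := ((ContinuousLinearMap.mul ℝ A).flip (f s)).integral_comp_comm hi
      simp only [ContinuousLinearMap.flip_apply, ContinuousLinearMap.mul_apply'] at this
      rw [this, integral_indicator (measurableSet_simplex s n)]
      rfl
    · simp [indicator_of_notMem hs]
  constructor
  · rw [← integrable_indicator_iff measurableSet_Ioo]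
    have := hint'.integral_prod_left
    simpa only [hinner] using this
  · rw [algIteratedIntegral, ← integral_indicator (measurableSet_simplex _ _),
      ← hmp.integral_comp' (f := e.symm), ← integral_indicator measurableSet_Ioo]
    refine (integral_prod _ hint').trans ?_
    simp only [hinner]

theorem algIteratedIntegral_sub {f : ℝ → A} (hf : StronglyMeasurable f) {C : ℝ}
    (hC : ∀ s, ‖f s‖ ≤ C) (n : ℕ) {a t : ℝ} (ha : 0 ≤ a) (hat : a ≤ t) :
    algIteratedIntegral f (n + 1) t = algIteratedIntegral f (n + 1) a +
      ∫ s in a..t, algIteratedIntegral f n s * f s := by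
  have key : ∀ b, 0 ≤ b → IntervalIntegrable (fun s => algIteratedIntegral f n s * f s) volume 0 b ∧
      algIteratedIntegral f (n + 1) b = ∫ s in (0)..b, algIteratedIntegral f n s * f s := by
    intro b hb
    obtain ⟨h1, h2⟩ := algIteratedIntegral_succ hf hC n b
    rw [intervalIntegrable_iff_integrableOn_Ioo_of_le hb, intervalIntegral.integral_of_le hb,
      integral_Ioc_eq_integral_Ioo]
    exact ⟨h1, h2⟩
  obtain ⟨h1, h2⟩ := key a ha
  obtain ⟨h3, h4⟩ := key t (ha.trans hat)
  rw [h2, h4, intervalIntegral.integral_add_adjacent_intervals h1 (h1.symm.trans h3)]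

/-- Chen's identity for a function that is constant on the last part of the interval. -/
theorem algIteratedIntegral_eq_sum_antidiagonal {f : ℝ → A} (hf : StronglyMeasurable f) {C : ℝ}
    (hC : ∀ s, ‖f s‖ ≤ C) {a b : ℝ} (ha : 0 ≤ a) {B : A} (hB : ∀ s ∈ Ioo a b, f s = B) (n : ℕ) :
    ∀ t ∈ Icc a b, algIteratedIntegral f n t = ∑ p ∈ Finset.HasAntidiagonal.antidiagonal n,
      algIteratedIntegral f p.1 a * ((p.2.factorial : ℝ)⁻¹ • ((t - a) • B) ^ p.2) := by
  induction n with
  | zero => intro t _; simp [algIteratedIntegral_zero]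
  | succ n ih =>
    rintro t ⟨hat, htb⟩
    -- The term `p.2 = 0` is the value at `a`; the others come from integrating `(s - a) ^ p.2`,
    -- which raises the exponent by one and completes the factorial.
    rw [algIteratedIntegral_sub hf hC n ha hat, Finset.Nat.sum_antidiagonal_succ']
    congr 1
    · simp
    have h1 : ∫ s in a..t, algIteratedIntegral f n s * f s =
        ∫ s in a..t, ∑ p ∈ Finset.HasAntidiagonal.antidiagonal n, (s - a) ^ p.2 •
          (algIteratedIntegral f p.1 a * ((p.2.factorial : ℝ)⁻¹ • B ^ (p.2 + 1))) := by
      rw [intervalIntegral.integral_of_le hat, intervalIntegral.integral_of_le hat,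
        integral_Ioc_eq_integral_Ioo, integral_Ioc_eq_integral_Ioo]
      refine setIntegral_congr_fun measurableSet_Ioo fun s hs => ?_
      rw [hB s ⟨hs.1, hs.2.trans_le htb⟩, ih s ⟨hs.1.le, (hs.2.trans_le htb).le⟩, Finset.sum_mul]
      refine Finset.sum_congr rfl fun p _ => ?_
      simp only [smul_pow, smul_mul_assoc, mul_smul_comm, pow_succ, mul_assoc]
      rw [smul_comm]
    rw [h1, intervalIntegral.integral_finsetSum]
    · refine Finset.sum_congr rfl fun p _ => ?_
      rw [intervalIntegral.integral_smul_const,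
        intervalIntegral.integral_comp_sub_right (fun s => s ^ p.2) a]
      simp only [sub_self, integral_pow, ne_eq, Nat.add_eq_zero_iff, one_ne_zero, and_false,
        not_false_eq_true, zero_pow, sub_zero, smul_pow, mul_smul_comm, smul_smul]
      congr 1
      rw [Nat.factorial_succ]
      push_cast
      have : (p.2.factorial : ℝ) ≠ 0 := by positivity
      have : (p.2 : ℝ) + 1 ≠ 0 := by positivity
      field_simp
    · intro p _
      exact (Continuous.smul (by fun_prop) continuous_const).intervalIntegrable _ _

/-- The generating series of the iterated integrals of a step function is the product of the
exponentials of the increments. -/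
theorem hasSum_algIteratedIntegral {f : ℝ → A} (hf : StronglyMeasurable f) {C : ℝ}
    (hC : ∀ s, ‖f s‖ ≤ C) {r : ℕ} {t : ℕ → ℝ} (h0 : t 0 = 0) (ht : ∀ i < r, t i < t (i + 1))
    {B : ℕ → A} (hB : ∀ i < r, ∀ s ∈ Ioo (t i) (t (i + 1)), f s = B i) :
    ∀ i ≤ r, 0 ≤ t i ∧ Summable (fun n => ‖algIteratedIntegral f n (t i)‖) ∧
      ∑' n, algIteratedIntegral f n (t i) =
        ((List.range i).map fun j => NormedSpace.exp ((t (j + 1) - t j) • B j)).prod := by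
  intro i
  induction i with
  | zero =>
    intro _
    have h : ∀ n ≠ 0, algIteratedIntegral f n (t 0) = 0 := by
      intro n hn
      obtain ⟨m, rfl⟩ := Nat.exists_eq_succ_of_ne_zero hn
      rw [h0]
      exact algIteratedIntegral_succ_zero f m
    refine ⟨h0.ge, summable_of_ne_finset_zero (s := {0}) fun n hn => ?_, ?_⟩
    · rw [h n (by simpa using hn), norm_zero]
    · rw [tsum_eq_single 0 h, algIteratedIntegral_zero]
      simp
  | succ i ih =>
    intro hi
    obtain ⟨hti, hs, he⟩ := ih (by omega)
    have hlt := ht i (by omega)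
    have hc : ∀ n, algIteratedIntegral f n (t (i + 1)) = ∑ p ∈ Finset.HasAntidiagonal.antidiagonal n,
        algIteratedIntegral f p.1 (t i) *
          ((p.2.factorial : ℝ)⁻¹ • ((t (i + 1) - t i) • B i) ^ p.2) := fun n =>
      algIteratedIntegral_eq_sum_antidiagonal hf hC hti (hB i (by omega)) n _ ⟨hlt.le, le_rfl⟩
    have hes := NormedSpace.norm_expSeries_summable' (𝕂 := ℝ) ((t (i + 1) - t i) • B i)
    have hsum := summable_norm_sum_mul_antidiagonal_of_summable_norm
      (f := fun n => algIteratedIntegral f n (t i))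
      (g := fun n => (n.factorial : ℝ)⁻¹ • ((t (i + 1) - t i) • B i) ^ n) hs hes
    have hprod := tsum_mul_tsum_eq_tsum_sum_antidiagonal_of_summable_norm
      (f := fun n => algIteratedIntegral f n (t i))
      (g := fun n => (n.factorial : ℝ)⁻¹ • ((t (i + 1) - t i) • B i) ^ n) hs hes
    have hexp := (NormedSpace.exp_series_hasSum_exp' (𝕂 := ℝ) ((t (i + 1) - t i) • B i)).tsum_eq
    refine ⟨hti.trans hlt.le, hsum.congr fun n => by rw [hc n], ?_⟩
    rw [List.range_succ, List.map_append, List.prod_append, ← he, List.map_singleton,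
      List.prod_singleton, ← hexp, hprod]
    exact tsum_congr hc

end Algebra

theorem exp_apply_of_apply_eq_smul {V : Type*} [NormedAddCommGroup V] [NormedSpace ℝ V]
    [CompleteSpace V] (S : V →L[ℝ] V) {v : V} {c : ℝ} (h : S v = c • v) :
    NormedSpace.exp S v = Real.exp c • v := by
  have hp : ∀ n : ℕ, (S ^ n) v = c ^ n • v := by
    intro n
    induction n with
    | zero => simp
    | succ n ih => rw [pow_succ, mul_apply_eq_comp, h, map_smul, ih, smul_smul, pow_succ']
  have h1 := (ContinuousLinearMap.apply ℝ V v).hasSum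
    (NormedSpace.exp_series_hasSum_exp' (𝕂 := ℝ) S)
  have h2 := (NormedSpace.exp_series_hasSum_exp' (𝕂 := ℝ) c).smul_const v
  rw [← Real.exp_eq_exp_ℝ] at h2
  refine h1.unique (h2.congr_fun ?_)
  intro n
  simp [hp, smul_smul]

/-! ### The space `ℝ × E` with its Euclidean norm -/

section Lorentz

/-- The space `ℝ × E` of a time and a space component, with the Euclidean norm. -/
def TimeSpace (E : Type*) : Type _ := WithLp 2 (ℝ × E)

namespace TimeSpace

section Components

variable {E : Type*}

/-- The vector with given components. -/
def mk (s : ℝ) (y : E) : TimeSpace E := WithLp.toLp 2 (s, y)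

/-- The time component. -/
def time (p : TimeSpace E) : ℝ := WithLp.fst p

/-- The space component. -/
def space (p : TimeSpace E) : E := WithLp.snd p

@[ext]
theorem ext {p q : TimeSpace E} (h₁ : p.time = q.time) (h₂ : p.space = q.space) : p = q :=
  WithLp.ofLp_injective 2 (Prod.ext h₁ h₂)

@[simp] theorem time_mk (s : ℝ) (y : E) : (mk s y).time = s := rfl
@[simp] theorem space_mk (s : ℝ) (y : E) : (mk s y).space = y := rfl

variable [NormedAddCommGroup E]

noncomputable instance : NormedAddCommGroup (TimeSpace E) :=
  inferInstanceAs (NormedAddCommGroup (WithLp 2 (ℝ × E)))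

instance [CompleteSpace E] : CompleteSpace (TimeSpace E) :=
  inferInstanceAs (CompleteSpace (WithLp 2 (ℝ × E)))

@[simp] theorem time_zero : (0 : TimeSpace E).time = 0 := rfl
@[simp] theorem space_zero : (0 : TimeSpace E).space = 0 := rfl
@[simp] theorem time_neg (p : TimeSpace E) : (-p).time = -p.time := rfl
@[simp] theorem space_neg (p : TimeSpace E) : (-p).space = -p.space := rfl
@[simp] theorem time_add (p q : TimeSpace E) : (p + q).time = p.time + q.time := rfl
@[simp] theorem space_add (p q : TimeSpace E) : (p + q).space = p.space + q.space := rfl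

theorem norm_sq_eq (p : TimeSpace E) : ‖p‖ ^ 2 = p.time ^ 2 + ‖p.space‖ ^ 2 := by
  refine (WithLp.prod_norm_sq_eq_of_L2 p).trans ?_
  rw [Real.norm_eq_abs, sq_abs]
  rfl

instance : Nontrivial (TimeSpace E) :=
  ⟨mk 0 0, mk 1 0, fun h => zero_ne_one (congrArg time h)⟩

theorem norm_mk_of_norm_eq {s : ℝ} {y : E} (h : ‖y‖ = s) : ‖mk s y‖ = √2 * s := by
  have hs : 0 ≤ s := h ▸ norm_nonneg y
  rw [← sq_eq_sq₀ (norm_nonneg _) (by positivity), norm_sq_eq, mul_pow, Real.sq_sqrt zero_le_two,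
    time_mk, space_mk, h]
  ring

end Components

variable {E : Type*} [NormedAddCommGroup E] [InnerProductSpace ℝ E]

noncomputable instance : NormedSpace ℝ (TimeSpace E) :=
  inferInstanceAs (NormedSpace ℝ (WithLp 2 (ℝ × E)))

@[simp] theorem time_smul (c : ℝ) (p : TimeSpace E) : (c • p).time = c * p.time := rfl
@[simp] theorem space_smul (c : ℝ) (p : TimeSpace E) : (c • p).space = c • p.space := rfl

end TimeSpace

/-! ### Lorentz boosts and their action on the light cone -/

variable {E : Type*} [NormedAddCommGroup E] [InnerProductSpace ℝ E]

/-- The generator `(s, x) ↦ (⟪v, x⟫, s v)` of the Lorentz boosts in direction `v`. -/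
noncomputable def boostGenerator : E →L[ℝ] (TimeSpace E →L[ℝ] TimeSpace E) :=
  LinearMap.mkContinuous₂
    (LinearMap.mk₂ ℝ (fun v p => TimeSpace.mk (inner ℝ v p.space) (p.time • v))
      (fun u v p => by ext <;> simp [inner_add_left])
      (fun c v p => by ext <;> simp [real_inner_smul_left, smul_smul, mul_comm])
      (fun v p q => by ext <;> simp [inner_add_right, add_smul])
      (fun c v p => by ext <;> simp [inner_smul_right, mul_smul]))
    1 (fun v p => by
      rw [one_mul]
      refine abs_le_of_sq_le_sq' ?_ (by positivity) |>.2
      rw [mul_pow, TimeSpace.norm_sq_eq, TimeSpace.norm_sq_eq]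
      have h := abs_real_inner_le_norm v p.space
      have h2 : (inner ℝ v p.space) ^ 2 ≤ (‖v‖ * ‖p.space‖) ^ 2 := sq_le_sq' (by
        linarith [neg_abs_le (inner ℝ v p.space)]) ((le_abs_self _).trans h)
      simp only [LinearMap.mk₂_apply, TimeSpace.time_mk, TimeSpace.space_mk, norm_smul, mul_pow,
        Real.norm_eq_abs, sq_abs] at h2 ⊢
      linarith)

theorem boostGenerator_apply (v : E) (s : ℝ) (y : E) :
    boostGenerator v (TimeSpace.mk s y) = TimeSpace.mk (inner ℝ v y) (s • v) := rfl

theorem norm_boostGenerator_le : ‖(boostGenerator : E →L[ℝ] _)‖ ≤ 1 :=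
  LinearMap.mkContinuous₂_norm_le _ zero_le_one _

/-- The vectors `(1, w)`, `(1, -w)` and `(0, y - ⟪w, y⟫ w)` are eigenvectors of the generator with
eigenvalues `a`, `-a`, `0`, and they span `(s, y)`. -/
theorem exp_boostGenerator_apply [CompleteSpace E] {w : E} (hw : ‖w‖ = 1) (a s : ℝ) (y : E) :
    NormedSpace.exp (boostGenerator (a • w)) (TimeSpace.mk s y) = TimeSpace.mk
      (((s + inner ℝ w y) * Real.exp a + (s - inner ℝ w y) * Real.exp (-a)) / 2)
        (y + (((s + inner ℝ w y) * Real.exp a - (s - inner ℝ w y) * Real.exp (-a)) / 2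
          - inner ℝ w y) • w) := by
  set x := inner ℝ w y with hx
  have hww : inner ℝ w w = (1 : ℝ) := by rw [real_inner_self_eq_norm_sq, hw, one_pow]
  have e1 := exp_apply_of_apply_eq_smul (boostGenerator (a • w))
    (v := TimeSpace.mk 1 w) (c := a) (by
      rw [boostGenerator_apply]
      ext <;> simp [inner_smul_left, hw])
  have e2 := exp_apply_of_apply_eq_smul (boostGenerator (a • w))
    (v := TimeSpace.mk 1 (-w)) (c := -a) (by
      rw [boostGenerator_apply]
      ext <;> simp [inner_smul_left, hw])
  have e3 := exp_apply_of_apply_eq_smul (boostGenerator (a • w))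
    (v := TimeSpace.mk 0 (y - x • w)) (c := 0) (by
      rw [boostGenerator_apply]
      ext <;> simp [inner_smul_left, inner_smul_right, inner_sub_right, hw, ← hx, mul_comm])
  have hd : TimeSpace.mk s y = ((s + x) / 2) • TimeSpace.mk 1 w +
      ((s - x) / 2) • TimeSpace.mk 1 (-w) + TimeSpace.mk 0 (y - x • w) := by
    ext
    · simp; ring
    · simp; module
  generalize NormedSpace.exp (boostGenerator (a • w)) = S at e1 e2 e3 ⊢
  rw [hd, map_add, map_add, map_smul, map_smul, e1, e2, e3]
  ext
  · simp; ring
  · simp; module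

/-- A boost of rapidity `a ≥ log (2 / (1 - c))` in direction `w` maps light vectors whose direction
is not too close to `-w` to longer light vectors whose direction is close to `w`. -/
theorem exp_boostGenerator_light [CompleteSpace E] {w : E} (hw : ‖w‖ = 1) {a c s : ℝ} {y : E}
    (hc0 : 0 ≤ c) (hc1 : c < 1) (ha : 2 ≤ Real.exp a * (1 - c)) (hy : ‖y‖ = s)
    (hwy : -(c * s) ≤ inner ℝ w y) :
    ∃ s' y', NormedSpace.exp (boostGenerator (a • w)) (TimeSpace.mk s y) = TimeSpace.mk s' y' ∧
      ‖y'‖ = s' ∧ s ≤ s' ∧ c * s' ≤ inner ℝ w y' := by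
  have hs : 0 ≤ s := hy ▸ norm_nonneg y
  have hww : inner ℝ w w = (1 : ℝ) := by rw [real_inner_self_eq_norm_sq, hw, one_pow]
  have hyy : inner ℝ y y = s ^ 2 := by rw [real_inner_self_eq_norm_sq, hy]
  have hxs : inner ℝ w y ≤ s := by
    have := real_inner_le_norm w y
    rwa [hw, hy, one_mul] at this
  refine ⟨_, _, exp_boostGenerator_apply hw a s y, ?_, ?_, ?_⟩
  all_goals
    set x := inner ℝ w y with hx
    set p := Real.exp a with hp
    set q := Real.exp (-a) with hq
    have hp0 : 0 < p := Real.exp_pos _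
    have hq0 : 0 < q := Real.exp_pos _
    have hpq : p * q = 1 := by rw [hp, hq, ← Real.exp_add]; simp
    have h1 : s * (1 - c) ≤ s + x := by linarith
    have h2 : 2 * s ≤ (s + x) * p := by nlinarith [mul_le_mul_of_nonneg_right h1 hp0.le]
    have h3 : 0 ≤ (s - x) * q := mul_nonneg (by linarith) hq0.le
  · rw [← sq_eq_sq₀ (norm_nonneg _) (by linarith), ← real_inner_self_eq_norm_sq]
    simp only [inner_add_left, inner_add_right, inner_smul_left, inner_smul_right, hyy, hww,
      real_inner_comm w y, ← hx, conj_trivial]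
    -- The boost preserves the Lorentz form because `p * q = 1`.
    linear_combination (-(s + x) * (s - x)) * hpq
  · linarith
  -- The claim is `(1 + c) (s - x) q ≤ (1 - c) (s + x) p`; the number `2 s (1 - c)` separates the
  -- two sides.
  · simp only [inner_add_right, inner_smul_right, hww, ← hx]
    have h4 : 2 * q ≤ 1 - c := by nlinarith
    have h5 : (s - x) * q ≤ (2 * s) * q := mul_le_mul_of_nonneg_right (by nlinarith) hq0.le
    have h6 : (2 * s) * q ≤ s * (1 - c) := by nlinarith
    have h7 : (1 - c) * (2 * s) ≤ (1 - c) * ((s + x) * p) :=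
      mul_le_mul_of_nonneg_left h2 (by linarith)
    have h8 : (1 + c) * ((s - x) * q) ≤ 2 * (s * (1 - c)) := by nlinarith
    nlinarith

open InnerProductGeometry in
/-- The operator norm of a product of boosts of large rapidity, with consecutive directions not
too close to opposite, is large. -/
theorem le_norm_prod_exp_boostGenerator [CompleteSpace E] {v : ℕ → E} {r : ℕ} {K θ : ℝ}
    (hr : 1 ≤ r) (hK : 2 / (1 - Real.cos θ) ≤ Real.exp K) (hv : ∀ i < r, v i ≠ 0)
    (hvK : ∀ i < r, K ≤ ‖v i‖) (hθ0 : 0 < θ) (hθ1 : θ ≤ Real.pi / 2)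
    (hangle : ∀ i, i + 1 < r → 2 * θ ≤ angle (-v i) (v (i + 1))) :
    Real.exp K ≤ ‖((List.range r).map fun j => NormedSpace.exp (boostGenerator (v j))).prod‖ := by
  have hc0 : 0 ≤ Real.cos θ := Real.cos_nonneg_of_neg_pi_div_two_le_of_le (by linarith) hθ1
  have hc1 : Real.cos θ < 1 := by
    have := Real.cos_lt_cos_of_nonneg_of_le_pi_div_two le_rfl hθ1 hθ0
    rwa [Real.cos_zero] at this
  have hexp : ∀ i < r, 2 ≤ Real.exp ‖v i‖ * (1 - Real.cos θ) := fun i hi => by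
    rw [← div_le_iff₀ (by linarith)]
    exact hK.trans (Real.exp_le_exp.2 (hvK i hi))
  have hunit : ∀ i < r, ‖(‖v i‖⁻¹ • v i)‖ = 1 := fun i hi => norm_smul_inv_norm (𝕜 := ℝ) (hv i hi)
  have hscale : ∀ i < r, ‖v i‖ • (‖v i‖⁻¹ • v i) = v i := fun i hi =>
    smul_inv_smul₀ (norm_ne_zero_iff.2 (hv i hi)) _
  set P : ℕ → (TimeSpace E →L[ℝ] TimeSpace E) := fun i =>
    ((List.range i).map fun j => NormedSpace.exp (boostGenerator (v j))).prod with hP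
  have hPs : ∀ i p, P (i + 1) p = P i (NormedSpace.exp (boostGenerator (v i)) p) := fun i p => by
    simp [hP, List.range_succ]
  -- `P i` holds only the factors before `v i`: the vector is in the forward cone of `v i`, as if
  -- that boost had just acted. The rightmost factor acts first, so the edges are met from last to
  -- first.
  have key : ∀ i < r, ∀ s y, ‖y‖ = s →
      Real.cos θ * s ≤ inner ℝ (‖v i‖⁻¹ • v i) y → √2 * s ≤ ‖P i (TimeSpace.mk s y)‖ := by
    intro i
    induction i with
    | zero =>
      intro _ s y hy _
      simp [hP, TimeSpace.norm_mk_of_norm_eq hy]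
    | succ i ih =>
      intro hi s y hy hin
      have hi' : i < r := by omega
      rw [hPs]
      -- Triangle inequality for angles: `y` is within `θ` of `v (i + 1)`, which is at least `2 * θ`
      -- from `-v i`, so `y` is at least `θ` from `-v i`.
      have hback : -(Real.cos θ * s) ≤ inner ℝ (‖v i‖⁻¹ • v i) y := by
        by_cases hy0 : y = 0
        · simp [hy0, ← hy]
        have hs : 0 < s := hy ▸ norm_pos_iff.2 hy0
        have ha1 : angle (v (i + 1)) y ≤ θ := by
          rw [← angle_smul_left_of_pos _ _ (inv_pos.2 (norm_pos_iff.2 (hv _ hi))), angle, hy,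
            hunit _ hi, one_mul, ← Real.arccos_cos hθ0.le (by linarith [Real.pi_pos])]
          exact Real.arccos_le_arccos ((le_div_iff₀ hs).2 hin)
        have ha2 := angle_le_angle_add_angle (-v i) y (v (i + 1))
        rw [angle_comm y] at ha2
        have ha3 : θ ≤ angle (-v i) y := by linarith [hangle i hi]
        have ha4 := Real.cos_le_cos_of_nonneg_of_le_pi hθ0.le (angle_le_pi _ _) ha3
        rw [cos_angle, norm_neg, inner_neg_left, hy,
          div_le_iff₀ (mul_pos (norm_pos_iff.2 (hv i hi')) hs)] at ha4
        rw [inner_smul_left, conj_trivial, ← div_eq_inv_mul,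
          le_div_iff₀ (norm_pos_iff.2 (hv i hi'))]
        linarith
      obtain ⟨s', y', h1, h2, h3, h4⟩ :=
        exp_boostGenerator_light (hunit i hi') hc0 hc1 (hexp i hi') hy hback
      rw [hscale i hi'] at h1
      rw [h1]
      exact (mul_le_mul_of_nonneg_left h3 (Real.sqrt_nonneg _)).trans (ih hi' s' y' h2 h4)
  obtain ⟨m, rfl⟩ : ∃ m, r = m + 1 := ⟨r - 1, by omega⟩
  have hm : m < m + 1 := by omega
  set w := ‖v m‖⁻¹ • v m with hw
  have hw1 : ‖w‖ = 1 := hunit m hm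
  have hww : inner ℝ w w = (1 : ℝ) := by rw [real_inner_self_eq_norm_sq, hw1, one_pow]
  -- The eigenvector `(1, w)` of the last boost gains the whole factor `exp ‖v m‖`; the other boosts
  -- need only not shrink it.
  have hfirst : NormedSpace.exp (boostGenerator (v m)) (TimeSpace.mk 1 w) =
      TimeSpace.mk (Real.exp ‖v m‖) (Real.exp ‖v m‖ • w) := by
    rw [exp_apply_of_apply_eq_smul (c := ‖v m‖) _ (by
      nth_rw 1 [← hscale m hm]
      rw [boostGenerator_apply, ← hw]
      ext <;> simp [inner_smul_left, hw1])]
    ext <;> simp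
  have hfin := key m hm (Real.exp ‖v m‖) (Real.exp ‖v m‖ • w)
    (by rw [norm_smul, hw1, mul_one, Real.norm_of_nonneg (Real.exp_pos _).le])
    (by
      rw [← hw, inner_smul_right, hww, mul_one]
      nlinarith [Real.exp_pos ‖v m‖])
  rw [← hfirst, ← hPs] at hfin
  have hop := (P (m + 1)).le_opNorm (TimeSpace.mk 1 w)
  rw [TimeSpace.norm_mk_of_norm_eq hw1, mul_one, mul_comm] at hop
  exact (Real.exp_le_exp.2 (hvK m hm)).trans
    (le_of_mul_le_mul_left (hfin.trans hop) (Real.sqrt_pos.2 zero_lt_two))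

end Lorentz

/-! ### Development of the signature of a piecewise linear path -/

section Development

variable {d : ℕ} {γ : ℝ → EuclideanSpace ℝ (Fin d)} {T : ℝ} {r : ℕ} {t : ℕ → ℝ}

theorem IsPiecewiseLinear.deriv_eq (hγ : IsPiecewiseLinear γ T r t) {i : ℕ} (hi : i < r) {s : ℝ}
    (hs : s ∈ Ioo (t i) (t (i + 1))) (j : Fin d) :
    deriv (fun s => γ s j) s = ((t (i + 1) - t i)⁻¹ • (γ (t (i + 1)) - γ (t i))) j := by
  have he : (fun s => γ s j) =ᶠ[nhds s] fun u =>
      (u - t i) * ((t (i + 1) - t i)⁻¹ • (γ (t (i + 1)) - γ (t i))) j + γ (t i) j := by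
    filter_upwards [Ioo_mem_nhds hs.1 hs.2] with u hu
    rw [hγ.linear i hi u ⟨hu.1.le, hu.2.le⟩, AffineMap.lineMap_apply]
    simp
    ring
  rw [he.deriv_eq]
  simp

theorem IsPiecewiseLinear.mem_iUnion_Ioo (hγ : IsPiecewiseLinear γ T r t) {s : ℝ}
    (hs : s ∈ Ioo 0 T) (hst : ∀ i, s ≠ t i) : ∃ i < r, s ∈ Ioo (t i) (t (i + 1)) := by
  by_contra! h
  have key : ∀ i ≤ r, t i < s := by
    intro i
    induction i with
    | zero => intro _; rw [hγ.zero]; exact hs.1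
    | succ i ih =>
      intro hi
      by_contra! hle
      exact h i (by omega) ⟨ih (by omega), hle.lt_of_ne (hst _)⟩
  have := key r le_rfl
  rw [hγ.last] at this
  exact this.not_gt hs.2

theorem norm_iteratedIntegral_zero_le (γ : ℝ → EuclideanSpace ℝ (Fin d)) (T : ℝ) :
    ‖iteratedIntegral γ T 0‖ ≤ 1 := by
  have h : coordIteratedIntegral γ T (isEmptyElim : Fin 0 → Fin d) = 1 := by
    simp [coordIteratedIntegral, volume_real_simplex_zero]
  rw [iteratedIntegral, Fintype.sum_unique, Subsingleton.elim default isEmptyElim, h, one_smul]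
  exact (PiTensorProduct.projectiveSeminorm_tprod_le _).trans (by simp)

variable {A : Type*} [NormedRing A] [NormedAlgebra ℝ A]

/-- The linear map `v₁ ⊗ ... ⊗ vₙ ↦ F v₁ ⋯ F vₙ`. -/
noncomputable def tensorDevelopment (F : EuclideanSpace ℝ (Fin d) →L[ℝ] A) (n : ℕ) :
    (⨂[ℝ]^n (EuclideanSpace ℝ (Fin d))) →ₗ[ℝ] A :=
  PiTensorProduct.lift ((ContinuousMultilinearMap.mkPiAlgebraFin ℝ n A).compContinuousLinearMap
    fun _ => F).toMultilinearMap

/-- The projective norm is what makes a linear map on the tensor power inherit the bound of its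
multilinear map, here `‖F‖ ^ n`. -/
theorem norm_tensorDevelopment_le [NormOneClass A] (F : EuclideanSpace ℝ (Fin d) →L[ℝ] A) (n : ℕ)
    (x : ⨂[ℝ]^n (EuclideanSpace ℝ (Fin d))) : ‖tensorDevelopment F n x‖ ≤ ‖F‖ ^ n * ‖x‖ := by
  refine (PiTensorProduct.norm_eval_le_projectiveSeminorm _ x).trans ?_
  gcongr
  refine (ContinuousMultilinearMap.norm_compContinuousLinearMap_le _ _).trans ?_
  simp [ContinuousMultilinearMap.norm_mkPiAlgebraFin]

variable [CompleteSpace A]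

theorem IsPiecewiseLinear.exists_tensorDevelopment_iteratedIntegral
    (hγ : IsPiecewiseLinear γ T r t) (F : EuclideanSpace ℝ (Fin d) →L[ℝ] A) :
    ∃ f : ℝ → A, StronglyMeasurable f ∧ (∃ C, ∀ s, ‖f s‖ ≤ C) ∧
      (∀ i < r, ∀ s ∈ Ioo (t i) (t (i + 1)),
        f s = F ((t (i + 1) - t i)⁻¹ • (γ (t (i + 1)) - γ (t i)))) ∧
      ∀ n, tensorDevelopment F n (iteratedIntegral γ T n) = algIteratedIntegral f n T := by
  set slope : ℕ → EuclideanSpace ℝ (Fin d) := fun i =>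
    (t (i + 1) - t i)⁻¹ • (γ (t (i + 1)) - γ (t i)) with hslope
  set U : Set ℝ := ⋃ i ∈ Finset.range r, Ioo (t i) (t (i + 1)) with hU
  have hUm : MeasurableSet U := Finset.measurableSet_biUnion _ fun _ _ => measurableSet_Ioo
  have hmemU : ∀ s, s ∈ U ↔ ∃ i < r, s ∈ Ioo (t i) (t (i + 1)) := fun s => by
    simp only [hU, mem_iUnion, Finset.mem_range, exists_prop]
  -- Off the open edges nothing controls `deriv`, as `γ` is arbitrary outside `[0,T]`. Cutting it to
  -- zero gives a bounded measurable function and changes the integrand only on a null subset of the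
  -- simplex.
  set g : Fin d → ℝ → ℝ := fun j => U.indicator (deriv fun s => γ s j) with hg
  have hgm : ∀ j, Measurable (g j) := fun j => (measurable_deriv _).indicator hUm
  have hgval : ∀ j, ∀ i < r, ∀ s ∈ Ioo (t i) (t (i + 1)), g j s = slope i j := by
    intro j i hi s hs
    rw [hg]
    simp only
    rw [indicator_of_mem ((hmemU s).2 ⟨i, hi, hs⟩), hγ.deriv_eq hi hs]
  set C : ℝ := ∑ i ∈ Finset.range r, ‖slope i‖ with hC
  have hgC : ∀ j s, ‖g j s‖ ≤ C := by
    intro j s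
    by_cases hs : s ∈ U
    · obtain ⟨i, hi, his⟩ := (hmemU s).1 hs
      rw [hgval j i hi s his]
      exact (PiLp.norm_apply_le _ _).trans (Finset.single_le_sum (f := fun i => ‖slope i‖)
        (fun _ _ => norm_nonneg _) (Finset.mem_range.2 hi))
    · simp only [hg, indicator_of_notMem hs, norm_zero]
      exact Finset.sum_nonneg fun _ _ => norm_nonneg _
  set f : ℝ → A := fun s => ∑ j, g j s • F (EuclideanSpace.single j 1) with hf
  refine ⟨f, ?_, ⟨∑ j : Fin d, C * ‖F (EuclideanSpace.single j 1)‖, fun s => ?_⟩, ?_, fun n => ?_⟩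
  · exact Finset.stronglyMeasurable_fun_sum _ fun j _ =>
      (hgm j).stronglyMeasurable.smul stronglyMeasurable_const
  · refine (norm_sum_le _ _).trans (Finset.sum_le_sum fun j _ => ?_)
    rw [norm_smul]
    gcongr
    exact hgC j s
  · intro i hi s hs
    simp only [hf, hgval _ i hi s hs]
    have hb := (EuclideanSpace.basisFun (Fin d) ℝ).sum_repr (slope i)
    simp only [EuclideanSpace.basisFun_repr, EuclideanSpace.basisFun_apply] at hb
    change _ = F (slope i)
    conv_rhs => rw [← hb, map_sum]
    simp only [map_smul]
  · have hcoord : ∀ I : Fin n → Fin d,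
        coordIteratedIntegral γ T I = ∫ u in simplex T n, ∏ k, g (I k) (u k) := by
      intro I
      refine setIntegral_congr_ae (measurableSet_simplex T n) ?_
      have hae : ∀ᵐ u : Fin n → ℝ, ∀ k i, u k ≠ t i := by
        refine ae_all_iff.2 fun k => ?_
        have h1 : ∀ᵐ s : ℝ, ∀ i, s ≠ t i := ae_all_iff.2 fun i => Measure.ae_ne volume (t i)
        exact (Measure.quasiMeasurePreserving_eval (fun _ : Fin n => (volume : Measure ℝ)) k).ae h1
      filter_upwards [hae] with u hu huS
      refine Finset.prod_congr rfl fun k _ => ?_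
      rw [hg]
      simp only
      rw [indicator_of_mem ((hmemU _).2 (hγ.mem_iUnion_Ioo (huS.2 k) (hu k)))]
    have hint : ∀ I : Fin n → Fin d,
        IntegrableOn (fun u : Fin n → ℝ => ∏ k, g (I k) (u k)) (simplex T n) := by
      intro I
      refine IntegrableOn.of_bound (volume_simplex_lt_top T n) (Measurable.aestronglyMeasurable ?_)
        (C ^ n) (Filter.Eventually.of_forall fun u => ?_)
      · exact Finset.measurable_fun_prod _ fun k _ => (hgm _).comp (measurable_pi_apply k)
      · rw [norm_prod]
        refine (Finset.prod_le_prod (fun _ _ => norm_nonneg _) fun k _ => hgC _ _).trans ?_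
        simp
    have hprod : ∀ u : Fin n → ℝ, (List.ofFn fun k => f (u k)).prod =
        ∑ I : Fin n → Fin d, (∏ k, g (I k) (u k)) •
          (List.ofFn fun k => F (EuclideanSpace.single (I k) 1)).prod := by
      intro u
      -- Multilinearity expands the noncommutative product over all words `I`.
      have h1 := (MultilinearMap.mkPiAlgebraFin ℝ n A).map_sum
        fun (k : Fin n) (j : Fin d) => g j (u k) • F (EuclideanSpace.single j 1)
      simp only [MultilinearMap.map_smul_univ, MultilinearMap.mkPiAlgebraFin_apply] at h1
      exact h1
    rw [algIteratedIntegral]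
    simp only [hprod]
    rw [integral_finsetSum _ fun I _ => (hint I).smul_const _, iteratedIntegral, map_sum]
    refine Finset.sum_congr rfl fun I _ => ?_
    rw [integral_smul_const, map_smul, hcoord I, tensorDevelopment, PiTensorProduct.lift.tprod]
    simp

/-- The development of a piecewise linear path is the product of the exponentials of its edges, and
is bounded by the signature. -/
theorem IsPiecewiseLinear.exists_hasSum_development [NormOneClass A] (hγ : IsPiecewiseLinear γ T r t)
    (F : EuclideanSpace ℝ (Fin d) →L[ℝ] A) :
    ∃ W : ℕ → A, (∀ n, ‖W n‖ ≤ ‖F‖ ^ n * ‖iteratedIntegral γ T n‖) ∧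
      Summable (fun n => ‖W n‖) ∧ ∑' n, W n =
        ((List.range r).map fun j => NormedSpace.exp (F (γ (t (j + 1)) - γ (t j)))).prod := by
  obtain ⟨f, hf, ⟨C, hC⟩, hB, hW⟩ := hγ.exists_tensorDevelopment_iteratedIntegral F
  obtain ⟨-, h1, h2⟩ := hasSum_algIteratedIntegral hf hC hγ.zero hγ.lt_succ hB r le_rfl
  rw [hγ.last] at h1 h2
  refine ⟨fun n => algIteratedIntegral f n T, fun n => ?_, h1, h2.trans ?_⟩
  · simp only
    rw [← hW n]
    exact norm_tensorDevelopment_le F n _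
  · congr 1
    refine List.map_congr_left fun j hj => ?_
    have hlt := hγ.lt_succ j (List.mem_range.1 hj)
    rw [← map_smul, smul_inv_smul₀ (sub_pos.2 hlt).ne']

theorem exp_le_of_hyperbolic_development (hγ : IsNondegenerate γ T r t) {D : ℝ}
    (hD : IsLeast (edgeLengths γ r t) D) {θ : ℝ} (hθ_pos : 0 < θ) (hθ_le : θ ≤ Real.pi / 2)
    (hθ : 2 ≤ r → IsLeast (adjacentAngles γ r t) (2 * θ)) {K : ℝ} (hK0 : 0 < K)
    (hK : 2 / (1 - Real.cos θ) ≤ Real.exp K) :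
    ∃ w : ℕ → ℝ, Summable w ∧ (∀ n, w n ≤ (K / D) ^ n * ‖iteratedIntegral γ T n‖) ∧
      Real.exp K ≤ ∑' n, w n := by
  obtain ⟨⟨i₀, hi₀, hDi₀⟩, hDmin⟩ := hD
  have hD0 : 0 < D := by
    rw [hDi₀]
    exact dist_pos.2 (hγ.edge_ne i₀ hi₀)
  have hα : 0 < K / D := div_pos hK0 hD0
  -- The scale `K / D` stretches the shortest edge to length exactly `K`.
  obtain ⟨W, hW1, hW2, hW3⟩ := hγ.toIsPiecewiseLinear.exists_hasSum_development
    ((K / D) • (boostGenerator (E := EuclideanSpace ℝ (Fin d))))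
  have hF : ‖(K / D) • (boostGenerator (E := EuclideanSpace ℝ (Fin d)))‖ ≤ K / D := by
    refine ContinuousLinearMap.opNorm_le_bound _ hα.le fun v => ?_
    rw [smul_apply, norm_smul, Real.norm_of_nonneg hα.le]
    gcongr
    simpa using (boostGenerator (E := EuclideanSpace ℝ (Fin d))).le_of_opNorm_le
      norm_boostGenerator_le v
  refine ⟨fun n => ‖W n‖, hW2, fun n => (hW1 n).trans (by gcongr), ?_⟩
  refine le_trans ?_ (norm_tsum_le_tsum_norm hW2)
  rw [hW3]
  have hmap : ∀ j, ((K / D) • (boostGenerator (E := EuclideanSpace ℝ (Fin d))))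
      (γ (t (j + 1)) - γ (t j)) = boostGenerator ((K / D) • (γ (t (j + 1)) - γ (t j))) := fun j => by
    rw [map_smul]
    rfl
  simp only [hmap]
  refine le_norm_prod_exp_boostGenerator (θ := θ) (by omega) hK (fun i hi => ?_) (fun i hi => ?_)
    hθ_pos hθ_le fun i hi => ?_
  · exact smul_ne_zero hα.ne' (sub_ne_zero.2 (hγ.edge_ne i hi).symm)
  · rw [norm_smul, Real.norm_of_nonneg hα.le, ← dist_eq_norm, dist_comm, div_mul_eq_mul_div,
      le_div_iff₀ hD0]
    exact mul_le_mul_of_nonneg_left (hDmin ⟨i, hi, rfl⟩) hK0.le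
  · refine ((hθ (by omega)).2 ⟨i, hi, rfl⟩).trans_eq ?_
    rw [← smul_neg, neg_sub, InnerProductGeometry.angle_smul_left_of_pos _ _ hα,
      InnerProductGeometry.angle_smul_right_of_pos _ _ hα]
    rfl

end Development

end PathSignature

/-! ### Comparison with the exponential series -/

theorem mainTheorem8 {d : ℕ} (γ : ℝ → EuclideanSpace ℝ (Fin d)) (T : ℝ) (r : ℕ) (t : ℕ → ℝ)
    (hγ : PathSignature.IsNondegenerate γ T r t)
    (D : ℝ) (hD : IsLeast (PathSignature.edgeLengths γ r t) D)
    (θ : ℝ) (hθ_pos : 0 < θ) (hθ_le : θ ≤ Real.pi / 2)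
    (hθ : 2 ≤ r → IsLeast (PathSignature.adjacentAngles γ r t) (2 * θ)) :
    (∃ n : ℕ, (2 / (1 - Real.cos θ)) ^ (1 - 1 / D) ≤
      (n.factorial : ℝ) * ‖PathSignature.iteratedIntegral γ T n‖) ∧
    ¬ PathSignature.HasTrivialSignature γ T := by
  have hc0 : 0 ≤ Real.cos θ :=
    Real.cos_nonneg_of_neg_pi_div_two_le_of_le (by linarith) hθ_le
  have hc1 : Real.cos θ < 1 := by
    have := Real.cos_lt_cos_of_nonneg_of_le_pi_div_two le_rfl hθ_le hθ_pos
    rwa [Real.cos_zero] at this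
  have hD0 : 0 < D := by
    obtain ⟨⟨i, hi, hDi⟩, -⟩ := hD
    rw [hDi]
    exact dist_pos.2 (hγ.edge_ne i hi)
  set Q := 2 / (1 - Real.cos θ) with hQ
  have hQ2 : 2 ≤ Q := by
    rw [hQ, le_div_iff₀ (by linarith)]
    linarith
  have hQ0 : 0 < Q := by linarith
  set K := Real.log Q with hKdef
  have hK0 : 0 < K := Real.log_pos (by linarith)
  have hexpK : Real.exp K = Q := Real.exp_log hQ0
  have hα : 0 < K / D := div_pos hK0 hD0
  obtain ⟨w, hw, hwle, hQw⟩ :=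
    PathSignature.exp_le_of_hyperbolic_development hγ hD hθ_pos hθ_le hθ hK0 hexpK.ge
  rw [hexpK] at hQw
  constructor
  · by_contra! h
    set M := Q ^ (1 - 1 / D) with hM
    have hexp : HasSum (fun n : ℕ => M * ((K / D) ^ n / n.factorial)) Q := by
      have h1 := (NormedSpace.expSeries_div_hasSum_exp (K / D)).mul_left M
      rw [← Real.exp_eq_exp_ℝ] at h1
      convert! h1 using 1
      rw [hM, Real.rpow_def_of_pos hQ0, ← hKdef, ← Real.exp_add, ← hexpK]
      congr 1
      ring
    have hlt : ∀ n, w n < M * ((K / D) ^ n / n.factorial) := by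
      intro n
      refine (hwle n).trans_lt ?_
      have hn : (0 : ℝ) < n.factorial := by positivity
      rw [← mul_div_assoc, lt_div_iff₀ hn]
      have := mul_lt_mul_of_pos_left (h n) (pow_pos hα n)
      linarith
    -- Strictness at the single index `0` makes the inequality of sums strict.
    have := hw.tsum_lt_tsum (fun n => (hlt n).le) (hlt 0) hexp.summable
    rw [hexp.tsum_eq] at this
    linarith
  · intro htriv
    have h0 := PathSignature.norm_iteratedIntegral_zero_le γ T
    have hle : ∀ n, n ≠ 0 → w n ≤ 0 := fun n hn => by
      have := hwle n
      rwa [htriv n (Nat.one_le_iff_ne_zero.2 hn), norm_zero, mul_zero] at this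
    -- A trivial signature leaves only the term `n = 0`, at most `1`, against a sum of at least `Q ≥
    -- 2`.
    have := hw.tsum_le_tsum (g := fun n => if n = 0 then 1 else 0) (fun n => ?_)
      (hasSum_ite_eq 0 (1 : ℝ)).summable
    · rw [tsum_ite_eq] at this
      linarith
    · by_cases hn : n = 0
      · subst hn
        simpa using (hwle 0).trans (by simpa using h0)
      · simpa [hn] using hle n hn
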